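/- Let $q$ be a prime power and let $C\subseteq \mathrm{GF}(q^m)^n$, $n\le m$, be a (linear or nonlinear) code with at least two codewords. The rank norm $\mathrm{rk}(\mathbf x)$ of $\mathbf x\in\mathrm{GF}(q^m)^n$ is the dimension over $\mathrm{GF}(q)$ of the span of its coordinates, the rank distance is $\mathrm{rk}(\mathbf x-\mathbf y)$, and $d_R$ is the minimum rank distance between distinct codewords of $C$. Assume that $C$ is a maximum rank distance code, i.e. $d_R=n-\log_{q^m}|C|+1$. Write $|C|=q^{mk}$, $r=n-k$ and $t=\lfloor (d_R-1)/2\rfloor$. A bounded rank distance decoder returns a codeword within rank distance $t$ of the received word if there is one, and declares a failure otherwise. For $0\le u\le n$ let $P_E(t;u)$ be the probability that, when a codeword $\mathbf c\in C$ is sent and the received word is $\mathbf c+\mathbf e$ with $\mathbf e$ uniformly distributed over the vectors of rank $u$ in $\mathrm{GF}(q^m)^n$, the decoder returns a codeword different from $\mathbf c$. Let $A(m,u)=\prod_{i=0}^{u-1}(q^m-q^i)$ (so $A(m,0)=1$) and let $V_t$ be the number of vectors of rank at most $t$ in $\mathrm{GF}(q^m)^n$. Then the following hold for every transmitted codeword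 $\mathbf c\in C$. 1. If $d_R-t\le u<d_R$, then $$P_E(t;u)<\frac{q^2}{q^2-1}\,\frac{(q^m-1)^{u-r}}{A(m,u)}\,V_t .$$ 2. If $d_R\le u\le n$, then $$P_E(t;u)\le\frac{A(m,u-r)}{A(m,u)}\,V_t ,$$ and this inequality is strict unless $d_R=1$ or $d_R=u=2$. -/

import Mathlib

namespace RankMetric

noncomputable section

/-- The rank norm over `F` of a vector `x` with entries in `K`: the dimension over `F` of the
subspace of `K` spanned by the coordinates of `x`. It is the rank of the matrix obtained by
expanding the coordinates in a basis, see `rankNorm_eq_rank_expansion`. -/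
def rankNorm (F : Type*) {K : Type*} [Field F] [Field K] [Algebra F K] {n : ℕ}
    (x : Fin n → K) : ℕ :=
  Module.finrank F (Submodule.span F (Set.range x))

/-- The rank norm is the rank of the matrix whose `j`-th column consists of the coordinates of
`x j` in an arbitrary basis of `K` over `F`. -/
theorem rankNorm_eq_rank_expansion {F K : Type*} [Field F] [Field K] [Algebra F K] {n m : ℕ}
    (b : Module.Basis (Fin m) F K) (x : Fin n → K) :
    rankNorm F x = (Matrix.of fun (i : Fin m) (j : Fin n) => b.repr (x j) i).rank := by
  rw [Matrix.rank_eq_finrank_span_cols, rankNorm]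
  have h : Set.range (Matrix.of fun (i : Fin m) (j : Fin n) => b.repr (x j) i).col
      = b.equivFun.toLinearMap '' Set.range x := by
    rw [← Set.range_comp]
    rfl
  rw [h, Submodule.span_image]
  exact (LinearEquiv.finrank_map_eq b.equivFun _).symm

/-- The rank distance. -/
def rankDist (F : Type*) {K : Type*} [Field F] [Field K] [Algebra F K] {n : ℕ}
    (x y : Fin n → K) : ℕ :=
  rankNorm F (x - y)

/-- The minimum rank distance over all pairs of distinct codewords
(meaningful for codes with at least two codewords). -/
def minRankDist (F : Type*) {K : Type*} [Field F] [Field K] [Algebra F K] {n : ℕ}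
    (C : Set (Fin n → K)) : ℕ :=
  sInf {d : ℕ | ∃ x ∈ C, ∃ y ∈ C, x ≠ y ∧ rankDist F x y = d}

/-- A (linear or nonlinear) code of length `n` over `K = GF(q^m)` is maximum rank distance (MRD)
if its minimum rank distance attains the Singleton bound `n - log_{q^m} |C| + 1`. -/
def IsMRD (F : Type*) {K : Type*} [Field F] [Field K] [Algebra F K] {n : ℕ}
    (C : Set (Fin n → K)) : Prop :=
  C.Nontrivial ∧
    (minRankDist F C : ℝ) = (n : ℝ) - Real.logb (Nat.card K : ℝ) (C.ncard : ℝ) + 1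

/-- `A(m,u) = ∏_{i=0}^{u-1} (q^m - q^i)`, for the prime power `q`; in particular `A(m,0) = 1`. -/
def A (q m u : ℕ) : ℝ :=
  ∏ i ∈ Finset.range u, ((q : ℝ) ^ m - (q : ℝ) ^ i)

/-- The volume of a ball of rank radius `t` in `K^n`. -/
def ballVolume (F K : Type*) [Field F] [Field K] [Algebra F K] (n t : ℕ) : ℕ :=
  {x : Fin n → K | rankNorm F x ≤ t}.ncard

/-- `D` is a bounded rank distance decoder of radius `t` for `C`: on a received word `y` it
returns a codeword within rank distance `t` of `y` if there is one, and declares a failure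
(`none`) otherwise. -/
def IsBoundedDistanceDecoder (F : Type*) {K : Type*} [Field F] [Field K] [Algebra F K] {n : ℕ}
    (C : Set (Fin n → K)) (t : ℕ) (D : (Fin n → K) → Option (Fin n → K)) : Prop :=
  ∀ y : Fin n → K,
    ((∃ c ∈ C, rankDist F y c ≤ t) → ∃ c ∈ C, rankDist F y c ≤ t ∧ D y = some c) ∧
    ((¬ ∃ c ∈ C, rankDist F y c ≤ t) → D y = none)

/-- The decoder error probability of `D` when `c` is transmitted and the additive error is
uniformly distributed over the vectors of rank `u`: the probability that the decoder returns
an estimate and that this estimate is not `c`. -/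
def decoderErrorProb (F : Type*) {K : Type*} [Field F] [Field K] [Algebra F K] {n : ℕ}
    (D : (Fin n → K) → Option (Fin n → K)) (c : Fin n → K) (u : ℕ) : ℝ :=
  ({e : Fin n → K | rankNorm F e = u ∧ ∃ c', D (c + e) = some c' ∧ c' ≠ c}.ncard : ℝ) /
    ({e : Fin n → K | rankNorm F e = u}.ncard : ℝ)

end

end RankMetric

/-! A vector of length n over K is a linear map V = F^n → K of the same rank, and translating by the
sent codeword puts 0 in the code. The minimum distance r + 1 makes a codeword determined by its
restriction to any k-dimensional subspace T; since the code has as many elements as Hom(T, K), every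
map on T is such a restriction (`IsMRDMaps.eq_of_eqOn`, `IsMRDMaps.exists_eqOn`).

Errors of rank u are sorted by their kernel N, of codimension u. Each N carries exactly A(m,u) maps
(`ncard_ker_eq`), so it is enough to bound, for each N, the maps y of kernel N that lie within t of
a nonzero codeword c (`div_le_of_fiber_le`).

If u > r, take T ⊇ N of dimension k. For fixed z = y - c, the map y is determined by its restriction
to T, which is an injection of T/N: this leaves A(m,u-r) choices for each z in the ball. Strictness
comes from a y in a translate of the code whose kernel meets T in N but is larger than N
(`IsMRDMaps.exists_translate_inf_eq`).

If u ≤ r, then dim N ≥ k and c = -z on N, so z determines c and hence y. Among the z of kernel L, of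
codimension ρ, such cancellation leaves at most A(m,ρ-(r-u)) of the A(m,ρ) maps
(`IsMRDMaps.ncard_cancel_le`). The ratio is estimated in `A_sub_mul_lt`, and summing over L gives
the bound. -/

namespace RankMetric

open Module

/-! ### Dimensions and bases relative to a subspace. -/

section Subspaces

variable {F V : Type*} [Field F] [AddCommGroup V] [Module F V]

theorem finrank_sup_span_singleton_of_notMem [FiniteDimensional F V] {T : Submodule F V} {x : V}
    (hx : x ∉ T) : finrank F (T ⊔ F ∙ x : Submodule F V) = finrank F T + 1 := by
  have := Submodule.finrank_sup_add_finrank_inf_eq T (F ∙ x)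
  have hx0 : x ≠ 0 := fun h => hx (h ▸ T.zero_mem)
  rw [((Submodule.disjoint_span_singleton' hx0).2 hx).eq_bot, finrank_span_singleton hx0,
    finrank_bot] at this
  omega

/-- A subspace can be enlarged to a subspace of any prescribed admissible dimension. -/
theorem exists_le_finrank_eq [FiniteDimensional F V] (X : Submodule F V) {j : ℕ}
    (h1 : finrank F X ≤ j) (h2 : j ≤ finrank F V) :
    ∃ T : Submodule F V, X ≤ T ∧ finrank F T = j := by
  induction j, h1 using Nat.le_induction with
  | base => exact ⟨X, le_rfl, rfl⟩
  | succ j hj ih =>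
    obtain ⟨T, hXT, hT⟩ := ih (by omega)
    have hlt : T < ⊤ := Submodule.lt_top_of_finrank_lt_finrank (by omega)
    obtain ⟨x, -, hx⟩ := SetLike.exists_of_lt hlt
    refine ⟨T ⊔ F ∙ x, hXT.trans le_sup_left, ?_⟩
    rw [finrank_sup_span_singleton_of_notMem hx, hT]

theorem finrank_map_mkQ_add [FiniteDimensional F V] {L T : Submodule F V} (h : L ≤ T) :
    finrank F (T.map L.mkQ) + finrank F L = finrank F T := by
  have := LinearMap.finrank_range_add_finrank_ker (L.mkQ.domRestrict T)
  rw [LinearMap.range_domRestrict, LinearMap.ker_domRestrict, Submodule.ker_mkQ,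
    (Submodule.comapSubtypeEquivOfLe h).finrank_eq] at this
  exact this

/-- A basis of `T` modulo `L`. -/
theorem exists_basis_mod [FiniteDimensional F V] {L T : Submodule F V} (h : L ≤ T) {a : ℕ}
    (ha : finrank F T = finrank F L + a) :
    ∃ w : Fin a → V, LinearIndependent F (L.mkQ ∘ w) ∧ L ⊔ Submodule.span F (Set.range w) = T := by
  have hfin : finrank F (T.map L.mkQ) = a := by
    have := finrank_map_mkQ_add h
    omega
  let b := finBasisOfFinrankEq F (T.map L.mkQ) hfin
  choose w hw using fun i => L.mkQ_surjective (b i : V ⧸ L)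
  have hw' : L.mkQ ∘ w = (T.map L.mkQ).subtype ∘ b := funext hw
  refine ⟨w, ?_, ?_⟩
  · rw [hw']
    exact b.linearIndependent.map' _ (Submodule.ker_subtype _)
  · rw [← Submodule.comap_map_mkQ, Submodule.map_span, ← Set.range_comp, hw', Set.range_comp,
      ← Submodule.map_span, b.span_eq, Submodule.map_top, Submodule.range_subtype,
      Submodule.comap_map_mkQ, sup_eq_right.2 h]

end Subspaces

/-! ### Linear maps, their kernels and prescribed values. -/

section Maps

variable {F V K : Type*} [Field F] [AddCommGroup V] [Module F V] [AddCommGroup K] [Module F K]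

theorem finrank_range_le_of_le_ker [FiniteDimensional F V] {f : V →ₗ[F] K} {N : Submodule F V}
    (h : N ≤ LinearMap.ker f) : finrank F (LinearMap.range f) + finrank F N ≤ finrank F V := by
  have h1 := LinearMap.finrank_range_add_finrank_ker f
  have h2 := Submodule.finrank_mono h
  omega

theorem eqOn_sup {f g : V →ₗ[F] K} {L M : Submodule F V} (h1 : ∀ x ∈ L, f x = g x)
    (h2 : ∀ x ∈ M, f x = g x) : ∀ x ∈ L ⊔ M, f x = g x := by
  have : L ⊔ M ≤ LinearMap.eqLocus f g := sup_le h1 h2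
  exact this

theorem eqOn_sup_span_range {f g : V →ₗ[F] K} {L : Submodule F V} {ι : Type*} {w : ι → V}
    (h1 : ∀ x ∈ L, f x = g x) (h2 : ∀ i, f (w i) = g (w i)) :
    ∀ x ∈ L ⊔ Submodule.span F (Set.range w), f x = g x := by
  have : L ⊔ Submodule.span F (Set.range w) ≤ LinearMap.eqLocus f g :=
    sup_le h1 (Submodule.span_le.2 (by rintro _ ⟨i, rfl⟩; exact h2 i))
  exact this

/-- Values on a family that is independent modulo `L` can be prescribed by a map vanishing
on `L`. -/
theorem exists_le_ker_apply_eq {L : Submodule F V} {ι : Type*} {w : ι → V}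
    (hw : LinearIndependent F (L.mkQ ∘ w)) (s : ι → K) :
    ∃ h : V →ₗ[F] K, L ≤ LinearMap.ker h ∧ ∀ i, h (w i) = s i := by
  let b := Basis.span hw
  obtain ⟨g, hg⟩ := LinearMap.exists_extend (b.constr F s)
  refine ⟨g ∘ₗ L.mkQ, ?_, fun i => ?_⟩
  · intro x hx
    simp [(Submodule.Quotient.mk_eq_zero L).2 hx]
  · have := LinearMap.congr_fun hg (b i)
    rw [Basis.constr_basis, LinearMap.comp_apply, Submodule.subtype_apply, Basis.span_apply] at this
    exact this

/-- A map whose kernel meets `T` exactly in `L` carries a basis of `T` modulo `L` to an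
independent family. -/
theorem linearIndependent_comp_of_ker_inf {L T : Submodule F V} {ι : Type*} {w : ι → V}
    (hw : LinearIndependent F (L.mkQ ∘ w)) (hT : L ⊔ Submodule.span F (Set.range w) = T)
    {f : V →ₗ[F] K} (hf : LinearMap.ker f ⊓ T = L) : LinearIndependent F (f ∘ w) := by
  rw [linearIndependent_iff'] at hw ⊢
  intro s c hc
  refine hw s c ?_
  have h1 : ∑ i ∈ s, c i • w i ∈ T := hT ▸ Submodule.mem_sup_right
    (Submodule.sum_mem _ fun i _ => Submodule.smul_mem _ _ (Submodule.subset_span ⟨i, rfl⟩))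
  have h2 : ∑ i ∈ s, c i • w i ∈ L := by
    rw [← hf]
    exact ⟨by simpa using hc, h1⟩
  have h3 : L.mkQ (∑ i ∈ s, c i • w i) = 0 := (Submodule.Quotient.mk_eq_zero L).2 h2
  rw [map_sum] at h3
  simpa only [map_smul, Function.comp_apply] using h3

/-- Conversely, a map vanishing on `L` and independent on a basis of `V` modulo `L` has kernel
`L`. -/
theorem ker_eq_of_linearIndependent_comp {L : Submodule F V} {ι : Type*} {w : ι → V}
    (hT : L ⊔ Submodule.span F (Set.range w) = ⊤) {f : V →ₗ[F] K} (hL : L ≤ LinearMap.ker f)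
    (hf : LinearIndependent F (f ∘ w)) : LinearMap.ker f = L := by
  refine le_antisymm (fun x hx => ?_) hL
  have hxT : x ∈ L ⊔ Submodule.span F (Set.range w) := hT ▸ Submodule.mem_top
  obtain ⟨l, hl, y, hy, rfl⟩ := Submodule.mem_sup.1 hxT
  obtain ⟨c, rfl⟩ := (Finsupp.mem_span_range_iff_exists_finsupp).1 hy
  have h0 : (c.sum fun i a => a • (f ∘ w) i) = 0 := by
    have h1 : f l = 0 := hL hl
    have h2 : f l + f (c.sum fun i a => a • w i) = 0 := by rw [← map_add]; exact hx
    rw [h1, zero_add, Finsupp.sum, map_sum] at h2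
    simpa [Finsupp.sum] using h2
  have hc : c = 0 := linearIndependent_iff.1 hf c h0
  simpa [hc] using hl

theorem finite_linearMap [Finite V] [Finite K] : Finite (V →ₗ[F] K) := DFunLike.finite _

end Maps

/-! ### Counting maps by their kernels. -/

section Counting

variable {F V K : Type*} [Field F] [Finite F] [AddCommGroup V] [Module F V] [Finite V]
  [AddCommGroup K] [Module F K] [Finite K]

/-- Fibrewise counting. -/
theorem ncard_eq_sum_fiber {α β : Type*} [Finite α] [Fintype β] (g : α → β) (S : Set α) :
    S.ncard = ∑ b, {a | a ∈ S ∧ g a = b}.ncard := by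
  classical
  have := Fintype.ofFinite α
  rw [Set.ncard_eq_toFinset_card', Finset.card_eq_sum_card_fiberwise (f := g)
    (t := Finset.univ) (fun _ _ => Finset.mem_coe.2 (Finset.mem_univ _))]
  refine Finset.sum_congr rfl fun b _ => ?_
  rw [Set.ncard_eq_toFinset_card']
  congr 1
  ext a
  simp

theorem card_linearIndependent_eq_A {a : ℕ} (ha : a ≤ finrank F K) :
    ({s : Fin a → K | LinearIndependent F s}.ncard : ℝ) = A (Nat.card F) (finrank F K) a := by
  classical
  have := Fintype.ofFinite F
  have h := card_linearIndependent (K := F) (V := K) ha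
  rw [← Nat.card_coe_set_eq]
  change ((Nat.card {s : Fin a → K // LinearIndependent F s} : ℕ) : ℝ) = _
  rw [h, A, Finset.prod_range, Nat.cast_prod]
  refine Finset.prod_congr rfl fun i _ => ?_
  rw [Nat.cast_sub, Nat.card_eq_fintype_card]
  · push_cast
    rfl
  · exact Nat.pow_le_pow_right Fintype.card_pos (by omega)

/-- Maps with kernel meeting `T` in `L` and determined by their restrictions to `T` are at most as
many as the injections of `T ⧸ L`. -/
theorem ncard_le_A_of_ker_inf {L T : Submodule F V} (hLT : L ≤ T) {a : ℕ}
    (hT : finrank F T = finrank F L + a) (ha : a ≤ finrank F K) {S : Set (V →ₗ[F] K)}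
    (hS : ∀ f ∈ S, LinearMap.ker f ⊓ T = L)
    (hinj : ∀ f ∈ S, ∀ g ∈ S, (∀ x ∈ T, f x = g x) → f = g) :
    (S.ncard : ℝ) ≤ A (Nat.card F) (finrank F K) a := by
  obtain ⟨w, hw, hspan⟩ := exists_basis_mod hLT hT
  rw [← card_linearIndependent_eq_A ha]
  norm_cast
  refine Set.ncard_le_ncard_of_injOn (fun f => f ∘ w)
    (fun f hf => linearIndependent_comp_of_ker_inf hw hspan (hS f hf)) ?_ (Set.toFinite _)
  intro f hf g hg hfg
  refine hinj f hf g hg ?_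
  rw [← hspan]
  refine eqOn_sup_span_range (fun x hx => ?_) (fun i => congrFun hfg i)
  have h1 : x ∈ LinearMap.ker f := ((hS f hf).symm ▸ hx : x ∈ LinearMap.ker f ⊓ T).1
  have h2 : x ∈ LinearMap.ker g := ((hS g hg).symm ▸ hx : x ∈ LinearMap.ker g ⊓ T).1
  rw [LinearMap.mem_ker.1 h1, LinearMap.mem_ker.1 h2]

/-- The number of maps with a prescribed kernel. -/
theorem ncard_ker_eq (L : Submodule F V) {a : ℕ} (hL : finrank F V = finrank F L + a)
    (ha : a ≤ finrank F K) :
    ({f : V →ₗ[F] K | LinearMap.ker f = L}.ncard : ℝ) = A (Nat.card F) (finrank F K) a := by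
  refine le_antisymm (ncard_le_A_of_ker_inf (L := L) (T := ⊤) le_top (by rw [finrank_top, hL]) ha
    (fun f hf => (inf_top_eq _).trans hf)
    (fun f _ g _ h => LinearMap.ext fun x => h x Submodule.mem_top)) ?_
  obtain ⟨w, hw, hspan⟩ := exists_basis_mod (L := L) (T := ⊤) le_top (by rw [finrank_top, hL])
  rw [← card_linearIndependent_eq_A ha]
  norm_cast
  have := finite_linearMap (F := F) (V := V) (K := K)
  choose h hL' hval using fun s : Fin a → K => exists_le_ker_apply_eq hw s
  refine Set.ncard_le_ncard_of_injOn h (fun s hs => ?_) (fun s _ s' _ hss => ?_) (Set.toFinite _)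
  · refine ker_eq_of_linearIndependent_comp hspan (hL' s) ?_
    rwa [show h s ∘ w = s from funext (hval s)]
  · funext i
    rw [← hval s, ← hval s', hss]

end Counting

/-- Maximum rank distance codes of dimension parameter `k` and minimum distance `r + 1`, as sets of
linear maps. -/
structure IsMRDMaps {F V K : Type*} [Field F] [AddCommGroup V] [Module F V] [AddCommGroup K]
    [Module F K] (C : Set (V →ₗ[F] K)) (k r : ℕ) : Prop where
  card_eq : C.ncard = Nat.card F ^ (finrank F K * k)
  add_eq : k + r = finrank F V
  lt_rank : ∀ f ∈ C, ∀ g ∈ C, f ≠ g → r < finrank F (LinearMap.range (f - g))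
  zero_mem : 0 ∈ C

/-! ### MRD codes of linear maps: interpolation, kernels, translates. -/

section Codes

variable {F V K : Type*} [Field F] [Finite F] [AddCommGroup V] [Module F V] [Finite V]
  [AddCommGroup K] [Module F K] [Finite K] {C : Set (V →ₗ[F] K)} {k r : ℕ}

omit [Finite F] [Finite K] in
/-- A codeword is determined by its restriction to a subspace of dimension `k`. -/
theorem IsMRDMaps.eq_of_eqOn (hC : IsMRDMaps C k r) {f g : V →ₗ[F] K} (hf : f ∈ C) (hg : g ∈ C)
    {T : Submodule F V} (hT : k ≤ finrank F T) (h : ∀ x ∈ T, f x = g x) : f = g := by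
  by_contra hne
  have h1 := hC.lt_rank f hf g hg hne
  -- The difference kills T, so its rank is at most n - k = r, below the minimum distance.
  have h2 := finrank_range_le_of_le_ker (f := f - g) (N := T)
    (fun x hx => by simp [h x hx])
  have h3 := hC.add_eq
  omega

omit [Finite F] in
/-- Every map on a subspace of dimension `k` extends to a codeword. -/
theorem IsMRDMaps.exists_eqOn (hC : IsMRDMaps C k r) {T : Submodule F V} (hT : finrank F T = k)
    (h : V →ₗ[F] K) : ∃ f ∈ C, ∀ x ∈ T, f x = h x := by
  have hfin := finite_linearMap (F := F) (V := T) (K := K)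
  have hinj : Set.InjOn (fun f : V →ₗ[F] K => f.domRestrict T) C := by
    intro f hf g hg hfg
    exact hC.eq_of_eqOn hf hg hT.ge fun x hx => LinearMap.congr_fun hfg ⟨x, hx⟩
  -- Restriction is injective, and both sides have q^(mk) elements.
  have himg : (fun f : V →ₗ[F] K => f.domRestrict T) '' C = Set.univ := by
    refine Set.eq_of_subset_of_ncard_le (Set.subset_univ _) ?_ (Set.toFinite _)
    rw [hinj.ncard_image, hC.card_eq, Set.ncard_univ,
      Module.natCard_eq_pow_finrank (K := F), Module.finrank_linearMap, hT, mul_comm]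
  obtain ⟨f, hf, hfh⟩ := himg.symm ▸ Set.mem_univ (h.domRestrict T)
  exact ⟨f, hf, fun x hx => LinearMap.congr_fun hfh ⟨x, hx⟩⟩

theorem card_ne_zero_subtype (α : Type*) [Finite α] [Zero α] :
    Nat.card {x : α // x ≠ 0} = Nat.card α - 1 := by
  classical
  have := Fintype.ofFinite α
  rw [Nat.card_eq_fintype_card, Nat.card_eq_fintype_card]
  exact Set.card_ne_eq 0

/-- Every subspace of codimension `v` with `r < v ≤ finrank F K` is the kernel of a codeword. -/
theorem IsMRDMaps.exists_ker_eq (hC : IsMRDMaps C k r) {N : Submodule F V} {v : ℕ}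
    (hN : finrank F V = finrank F N + v) (hrv : r < v) (hv : v ≤ finrank F K) :
    ∃ f ∈ C, LinearMap.ker f = N := by
  -- Counting: the codewords vanishing on N are parametrized by K^(v-r). If none has kernel exactly
  -- N, each nonzero one kills a nonzero vector of a complement W, and for each such vector there
  -- are too few of them.
  by_contra! hno
  have hkr := hC.add_eq
  obtain ⟨T, hNT, hT⟩ := exists_le_finrank_eq N (j := k) (by omega) (by omega)
  obtain ⟨w, hw, hspan⟩ := exists_basis_mod hNT (a := v - r) (by omega)
  have hex : ∀ s : {s : Fin (v - r) → K // s ≠ 0}, ∃ f ∈ C, N ≤ LinearMap.ker f ∧ f ∘ w = s := by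
    intro s
    obtain ⟨h, hh, hval⟩ := exists_le_ker_apply_eq hw s.1
    obtain ⟨f, hf, hfh⟩ := hC.exists_eqOn hT h
    refine ⟨f, hf, fun x hx => ?_, funext fun i => ?_⟩
    · rw [LinearMap.mem_ker, hfh x (hNT hx)]
      exact hh hx
    · rw [Function.comp_apply, hfh _ (hspan ▸ Submodule.mem_sup_right
        (Submodule.subset_span ⟨i, rfl⟩)), hval]
  choose f hfC hfN hfw using hex
  obtain ⟨W, hW⟩ := Submodule.exists_isCompl N
  have hWv : finrank F W = v := by
    have := Submodule.finrank_add_eq_of_isCompl hW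
    omega
  have hx : ∀ s, ∃ x : {x : W // x ≠ 0}, f s x.1 = 0 := by
    intro s
    obtain ⟨y, hy, hyN⟩ := SetLike.exists_of_lt ((hfN s).lt_of_ne (hno _ (hfC s)).symm)
    obtain ⟨a, ha, b, hb, rfl⟩ := Submodule.mem_sup.1 (hW.sup_eq_top ▸ Submodule.mem_top :
      y ∈ N ⊔ W)
    refine ⟨⟨⟨b, hb⟩, fun h0 => hyN ?_⟩, ?_⟩
    · rw [show b = 0 from congrArg Subtype.val h0, add_zero]
      exact ha
    · have h1 : f s a = 0 := hfN s ha
      have h2 : f s (a + b) = 0 := hy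
      rwa [map_add, h1, zero_add] at h2
  choose x hx using hx
  -- Vanishing at x as well costs one dimension: N + ⟨x⟩ extends to a k-dimensional space by only v
  -- - r - 1 further vectors ω.
  have hU : ∀ x : {x : W // x ≠ 0}, ∃ ω : Fin (v - r - 1) → V, ∀ f ∈ C, ∀ g ∈ C,
      N ≤ LinearMap.ker f → N ≤ LinearMap.ker g → f x.1 = 0 → g x.1 = 0 → f ∘ ω = g ∘ ω →
      f = g := by
    intro x
    have hxN : (x.1 : V) ∉ N := fun h => x.2 (Subtype.ext
      (Submodule.disjoint_def.1 hW.disjoint _ h x.1.2))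
    have hdim := finrank_sup_span_singleton_of_notMem hxN
    obtain ⟨U, hNU, hUk⟩ := exists_le_finrank_eq (N ⊔ F ∙ (x.1 : V)) (j := k) (by omega)
      (by omega)
    obtain ⟨ω, -, hω⟩ := exists_basis_mod hNU (a := v - r - 1) (by omega)
    refine ⟨ω, fun f hf g hg hfN hgN hfx hgx hfg => hC.eq_of_eqOn hf hg hUk.ge ?_⟩
    rw [← hω]
    refine eqOn_sup_span_range (eqOn_sup (fun y hy => ?_) fun y hy => ?_) (congrFun hfg)
    · rw [LinearMap.mem_ker.1 (hfN hy), LinearMap.mem_ker.1 (hgN hy)]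
    · obtain ⟨c, rfl⟩ := Submodule.mem_span_singleton.1 hy
      rw [map_smul, map_smul, hfx, hgx]
  choose ω hω using hU
  have hf0 : ∀ s, f s ∘ ω (x s) ≠ 0 := by
    intro s h0
    have : f s = 0 := hω (x s) _ (hfC s) 0 hC.zero_mem (hfN s) (by simp) (hx s) rfl h0
    exact s.2 (by rw [← hfw s, this]; rfl)
  let G : {s : Fin (v - r) → K // s ≠ 0} →
      {x : W // x ≠ 0} × {s : Fin (v - r - 1) → K // s ≠ 0} :=
    fun s => (x s, ⟨f s ∘ ω (x s), hf0 s⟩)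
  have hG : Function.Injective G := by
    intro s s' h
    have h1 : x s = x s' := congrArg Prod.fst h
    have h2 : f s ∘ ω (x s) = f s' ∘ ω (x s') := congrArg (fun p => p.2.1) h
    have h3 : f s = f s' := hω (x s) _ (hfC s) _ (hfC s') (hfN s) (hfN s') (hx s)
      (h1 ▸ hx s') (by rw [h2, h1])
    apply Subtype.ext
    rw [← hfw s, ← hfw s', h3]
  have hle := Nat.card_le_card_of_injective G hG
  have hq : 1 < Nat.card F := Finite.one_lt_card
  rw [Nat.card_prod, card_ne_zero_subtype, card_ne_zero_subtype, card_ne_zero_subtype,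
    Nat.card_fun, Nat.card_fun, Nat.card_fin, Nat.card_fin,
    Module.natCard_eq_pow_finrank (K := F) (V := W), hWv,
    Module.natCard_eq_pow_finrank (K := F) (V := K)] at hle
  have hexp : v - r = (v - r - 1) + 1 := by omega
  rw [hexp, pow_succ, Nat.add_sub_cancel] at hle
  have hva : Nat.card F ^ v ≤ Nat.card F ^ finrank F K := Nat.pow_le_pow_right (by omega) hv
  have ha : 2 ≤ Nat.card F ^ finrank F K := by
    calc 2 ≤ Nat.card F ^ 1 := by rw [pow_one]; exact hq
      _ ≤ _ := Nat.pow_le_pow_right (by omega) (by omega)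
  have hb : 1 ≤ (Nat.card F ^ finrank F K) ^ (v - r - 1) := Nat.one_le_pow _ _ (by omega)
  -- With a = q^m, b = q^(m(v-r-1)) and c = q^v ≤ a, the injection says ab - 1 ≤ (c-1)(b-1) ≤
  -- (a-1)(b-1), hence a + b ≤ 2, against a ≥ 2 and b ≥ 1.
  generalize (Nat.card F ^ finrank F K) ^ (v - r - 1) = b at *
  generalize Nat.card F ^ finrank F K = a at *
  generalize Nat.card F ^ v = c at *
  have h1 : (c - 1) * (b - 1) ≤ (a - 1) * (b - 1) := Nat.mul_le_mul_right _ (by omega)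
  obtain ⟨a, rfl⟩ := Nat.exists_eq_add_of_le' ha
  obtain ⟨b, rfl⟩ := Nat.exists_eq_add_of_le' hb
  have h2 : b * 1 ≤ (b + 1) * (a + 2) := by gcongr <;> omega
  have h3 : (b + 1) * (a + 2) - 1 ≤ (a + 2 - 1) * (b + 1 - 1) := hle.trans h1
  have h4 : (b + 1) * (a + 2) = (a + 1) * b + a + b + 2 := by ring
  rw [h4] at h3
  simp only [Nat.add_sub_cancel, show a + 2 - 1 = a + 1 from rfl] at h3
  omega

/-- For `T` of dimension `k`, the elements of a translate of the code whose kernel meets `T`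
exactly in `N`. -/
theorem IsMRDMaps.ncard_translate_le (hC : IsMRDMaps C k r) {N T : Submodule F V} {u : ℕ}
    (hN : finrank F V = finrank F N + u) (hru : r ≤ u) (hu : u ≤ finrank F K) (hNT : N ≤ T)
    (hT : finrank F T = k) (z : V →ₗ[F] K) :
    ({y | y - z ∈ C ∧ LinearMap.ker y ⊓ T = N}.ncard : ℝ) ≤
      A (Nat.card F) (finrank F K) (u - r) := by
  have hkr := hC.add_eq
  refine ncard_le_A_of_ker_inf hNT (by omega) (by omega) (fun f hf => hf.2) ?_
  intro f hf g hg hfg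
  have := hC.eq_of_eqOn hf.1 hg.1 hT.ge (fun x hx => by simp [hfg x hx])
  exact sub_left_injective (b := z) this

/-- The maps `z` with kernel `L` that cancel a nonzero codeword on `N`. -/
theorem IsMRDMaps.ncard_cancel_le (hC : IsMRDMaps C k r) {N L : Submodule F V} {u ρ : ℕ}
    (hN : finrank F V = finrank F N + u) (hL : finrank F V = finrank F L + ρ) (hur : u ≤ r)
    (hρ : ρ ≤ finrank F K)
    (hne : {z : V →ₗ[F] K | LinearMap.ker z = L ∧ ∃ c ∈ C, c ≠ 0 ∧ ∀ x ∈ N, c x = -z x}.Nonempty) :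
    r - u ≤ ρ ∧ ({z : V →ₗ[F] K | LinearMap.ker z = L ∧ ∃ c ∈ C, c ≠ 0 ∧ ∀ x ∈ N, c x = -z x}.ncard : ℝ) ≤
      A (Nat.card F) (finrank F K) (ρ - (r - u)) := by
  have hkr := hC.add_eq
  -- On L ∩ N the cancelled codeword vanishes, so dimension k there would force it to be 0.
  have hinf : finrank F (L ⊓ N : Submodule F V) < k := by
    obtain ⟨z, hz, c, hc, hc0, hcz⟩ := hne
    by_contra! hk
    refine hc0 (hC.eq_of_eqOn hc hC.zero_mem hk fun x hx => ?_)
    have : x ∈ LinearMap.ker z := hz ▸ hx.1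
    rw [hcz x hx.2, LinearMap.mem_ker.1 this]
    simp
  have h1 := Submodule.finrank_sup_add_finrank_inf_eq L N
  obtain ⟨W, hW⟩ := Submodule.exists_isCompl (L ⊔ N)
  have h2 := Submodule.finrank_add_eq_of_isCompl hW
  have h3 := Submodule.finrank_add_le_finrank_add_finrank L W
  have h4 : finrank F L ≤ finrank F (L ⊔ W : Submodule F V) := Submodule.finrank_mono le_sup_left
  -- This dimension is chosen so that T + N = V gives dim (T ∩ N) = k; the bound on dim (L ∩ N)
  -- leaves room for it.
  obtain ⟨T, hLT, hT⟩ := exists_le_finrank_eq (L ⊔ W) (j := finrank F V - (r - u)) (by omega)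
    (by omega)
  have hTN : T ⊔ N = ⊤ := by
    rw [eq_top_iff, ← hW.sup_eq_top]
    exact sup_le (sup_le ((le_sup_left.trans hLT).trans le_sup_left) le_sup_right)
      ((le_sup_right.trans hLT).trans le_sup_left)
  have h5 := Submodule.finrank_sup_add_finrank_inf_eq T N
  rw [hTN, finrank_top] at h5
  have hLT' : L ≤ T := le_sup_left.trans hLT
  refine ⟨by omega, ncard_le_A_of_ker_inf hLT' (by omega) (by omega)
    (fun f hf => by rw [hf.1, inf_eq_left.2 hLT']) ?_⟩
  rintro f ⟨-, c, hc, -, hcf⟩ g ⟨-, c', hc', -, hcg⟩ hfg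
  -- Agreement on T fixes the codeword through T ∩ N; the codeword then fixes the map on N, hence on
  -- T + N = V.
  have hcc : c = c' := hC.eq_of_eqOn (T := T ⊓ N) hc hc' (by omega)
    fun x hx => by rw [hcf x hx.2, hcg x hx.2, hfg x hx.1]
  refine LinearMap.ext fun x => eqOn_sup hfg (fun y hy => ?_) x (hTN ▸ Submodule.mem_top)
  rw [← neg_inj, ← hcf y hy, ← hcg y hy, hcc]

end Codes

/-! ### Estimates for A(m,u). -/

section Estimates

theorem A_pos {q m a : ℕ} (hq : 1 < q) (ha : a ≤ m) : 0 < A q m a := by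
  refine Finset.prod_pos fun i hi => sub_pos.2 ?_
  exact pow_lt_pow_right₀ (by exact_mod_cast hq) (lt_of_lt_of_le (Finset.mem_range.1 hi) ha)

/-- Induction on b: with x = q^(b-m), the step is (1 - x)(1 - x) > 1 - 2x ≥ 1 - qx. -/
theorem one_sub_lt_prod {q m a b : ℕ} (hq : 1 < q) (hab : a ≤ b) (hb : b ≤ m) :
    (1 - (q : ℝ) ^ b / (q : ℝ) ^ m) < ∏ i ∈ Finset.Ico a b, (1 - (q : ℝ) ^ i / (q : ℝ) ^ m) := by
  have hq2 : (2 : ℝ) ≤ q := by exact_mod_cast hq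
  have hm : (0 : ℝ) < (q : ℝ) ^ m := by positivity
  induction b, hab using Nat.le_induction with
  | base =>
    have : 0 < (q : ℝ) ^ a / (q : ℝ) ^ m := by positivity
    simp [this]
  | succ b hab ih =>
    rw [Finset.prod_Ico_succ_top hab]
    have hx : 0 < (q : ℝ) ^ b / (q : ℝ) ^ m := by positivity
    have hx1 : (q : ℝ) ^ b / (q : ℝ) ^ m < 1 := by
      rw [div_lt_one hm]
      exact pow_lt_pow_right₀ (by linarith) (by omega)
    have hs : (q : ℝ) ^ (b + 1) / (q : ℝ) ^ m = q * ((q : ℝ) ^ b / (q : ℝ) ^ m) := by ring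
    rw [hs]
    have h1 := mul_lt_mul_of_pos_right (ih (by omega)) (sub_pos.2 hx1)
    nlinarith

/-- The comparison of the two bounds on the numbers of injections. -/
theorem A_sub_mul_lt {q m ρ s : ℕ} (hq : 1 < q) (hs : s ≤ ρ) (hρ : ρ + 2 ≤ m) :
    A q m (ρ - s) * ((q : ℝ) ^ 2 - 1) * ((q : ℝ) ^ m - 1) ^ s < (q : ℝ) ^ 2 * A q m ρ := by
  have hq2 : (2 : ℝ) ≤ q := by exact_mod_cast hq
  have hm : (0 : ℝ) < (q : ℝ) ^ m := by positivity
  have hm1 : (1 : ℝ) < (q : ℝ) ^ m := one_lt_pow₀ (by linarith) (by omega)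
  have hA := A_pos (a := ρ - s) hq (by omega : ρ - s ≤ m)
  have hsplit : A q m ρ = A q m (ρ - s) * ∏ i ∈ Finset.Ico (ρ - s) ρ, ((q : ℝ) ^ m - (q : ℝ) ^ i) :=
    (Finset.prod_range_mul_prod_Ico _ (Nat.sub_le _ _)).symm
  -- Factor by factor: (q^m - 1)(1 - q^(i-m)) exceeds q^m - q^i by q^(i-m) - 1 ≤ 0.
  have h1 : ((q : ℝ) ^ m - 1) ^ s * ∏ i ∈ Finset.Ico (ρ - s) ρ, (1 - (q : ℝ) ^ i / (q : ℝ) ^ m) ≤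
      ∏ i ∈ Finset.Ico (ρ - s) ρ, ((q : ℝ) ^ m - (q : ℝ) ^ i) := by
    have hcard : (Finset.Ico (ρ - s) ρ).card = s := by rw [Nat.card_Ico]; omega
    nth_rewrite 1 [← hcard]
    rw [← Finset.prod_const, ← Finset.prod_mul_distrib]
    refine Finset.prod_le_prod (fun i hi => ?_) fun i hi => ?_
    · have : (q : ℝ) ^ i / (q : ℝ) ^ m ≤ 1 := by
        rw [div_le_one hm]
        exact pow_le_pow_right₀ (by linarith) (by have := Finset.mem_Ico.1 hi; omega)
      exact mul_nonneg (by linarith) (by linarith)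
    · have hlt : (q : ℝ) ^ i / (q : ℝ) ^ m ≤ (q : ℝ) ^ i := div_le_self (by positivity) hm1.le
      have hle : (1 : ℝ) ≤ (q : ℝ) ^ i := one_le_pow₀ (by linarith)
      have heq : ((q : ℝ) ^ m - 1) * (1 - (q : ℝ) ^ i / (q : ℝ) ^ m) =
        (q : ℝ) ^ m - (q : ℝ) ^ i - 1 + (q : ℝ) ^ i / (q : ℝ) ^ m := by field_simp; ring
      have hdiv : (q : ℝ) ^ i / (q : ℝ) ^ m ≤ 1 := by
        rw [div_le_one hm]
        exact pow_le_pow_right₀ (by linarith) (by have := Finset.mem_Ico.1 hi; omega)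
      linarith
  have h2 := one_sub_lt_prod hq (Nat.sub_le ρ s) (by omega : ρ ≤ m)
  -- Here ρ + 2 ≤ m enters, and with it the constant q²/(q²-1).
  have h3 : (q : ℝ) ^ 2 - 1 ≤ (q : ℝ) ^ 2 * (1 - (q : ℝ) ^ ρ / (q : ℝ) ^ m) := by
    have : (q : ℝ) ^ 2 * ((q : ℝ) ^ ρ / (q : ℝ) ^ m) ≤ 1 := by
      rw [← mul_div_assoc, ← pow_add, div_le_one hm]
      exact pow_le_pow_right₀ (by linarith) (by omega)
    linarith
  have h4 : (q : ℝ) ^ 2 - 1 < (q : ℝ) ^ 2 *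
      ∏ i ∈ Finset.Ico (ρ - s) ρ, (1 - (q : ℝ) ^ i / (q : ℝ) ^ m) :=
    h3.trans_lt (mul_lt_mul_of_pos_left h2 (by positivity))
  have hP : (0 : ℝ) < ((q : ℝ) ^ m - 1) ^ s := pow_pos (by linarith) _
  calc A q m (ρ - s) * ((q : ℝ) ^ 2 - 1) * ((q : ℝ) ^ m - 1) ^ s
      = (A q m (ρ - s) * ((q : ℝ) ^ m - 1) ^ s) * ((q : ℝ) ^ 2 - 1) := by ring
    _ < (A q m (ρ - s) * ((q : ℝ) ^ m - 1) ^ s) * ((q : ℝ) ^ 2 *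
          ∏ i ∈ Finset.Ico (ρ - s) ρ, (1 - (q : ℝ) ^ i / (q : ℝ) ^ m)) :=
        mul_lt_mul_of_pos_left h4 (mul_pos hA hP)
    _ = A q m (ρ - s) * (q : ℝ) ^ 2 * (((q : ℝ) ^ m - 1) ^ s *
          ∏ i ∈ Finset.Ico (ρ - s) ρ, (1 - (q : ℝ) ^ i / (q : ℝ) ^ m)) := by ring
    _ ≤ A q m (ρ - s) * (q : ℝ) ^ 2 * ∏ i ∈ Finset.Ico (ρ - s) ρ, ((q : ℝ) ^ m - (q : ℝ) ^ i) :=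
        mul_le_mul_of_nonneg_left h1 (by positivity)
    _ = (q : ℝ) ^ 2 * A q m ρ := by rw [hsplit]; ring

end Estimates

/-! ### Decodable maps with a given kernel. -/

section Decoding

variable {F V K : Type*} [Field F] [Finite F] [AddCommGroup V] [Module F V] [Finite V]
  [AddCommGroup K] [Module F K] [Finite K] {C : Set (V →ₗ[F] K)} {k r : ℕ}

/-- The maps of kernel `N` within rank distance `t` of a nonzero element of `C`. -/
def decodable (C : Set (V →ₗ[F] K)) (t : ℕ) (N : Submodule F V) : Set (V →ₗ[F] K) :=
  {y | LinearMap.ker y = N ∧ ∃ c ∈ C, c ≠ 0 ∧ finrank F (LinearMap.range (y - c)) ≤ t}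

/-- The maps of rank at most `t`. -/
def rankBall (F V K : Type*) [Field F] [AddCommGroup V] [Module F V] [AddCommGroup K]
    [Module F K] (t : ℕ) : Set (V →ₗ[F] K) :=
  {z | finrank F (LinearMap.range z) ≤ t}

/-- Union bound over the translates z + C, z in the ball. Each is bounded through the weaker
condition ker y ∩ T = N, so a single y satisfying it with ker y ≠ N makes the total strict. -/
theorem IsMRDMaps.ncard_decodable_le (hC : IsMRDMaps C k r) {N T : Submodule F V} {u t : ℕ}
    (hN : finrank F V = finrank F N + u) (hru : r ≤ u) (hu : u ≤ finrank F K) (hNT : N ≤ T)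
    (hT : finrank F T = k) :
    ((decodable C t N).ncard : ℝ) ≤
      A (Nat.card F) (finrank F K) (u - r) * (rankBall F V K t).ncard ∧
    ((∃ z ∈ rankBall F V K t, ∃ y, y - z ∈ C ∧ LinearMap.ker y ⊓ T = N ∧ LinearMap.ker y ≠ N) →
      ((decodable C t N).ncard : ℝ) <
        A (Nat.card F) (finrank F K) (u - r) * (rankBall F V K t).ncard) := by
  classical
  have hfin := finite_linearMap (F := F) (V := V) (K := K)
  let S : (V →ₗ[F] K) → Set (V →ₗ[F] K) := fun z => {y | y - z ∈ C ∧ LinearMap.ker y = N}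
  let B : Finset (V →ₗ[F] K) := (Set.toFinite (rankBall F V K t)).toFinset
  have hB : (rankBall F V K t).ncard = B.card := Set.ncard_eq_toFinset_card _ _
  have hsub : decodable C t N ⊆ ⋃ z ∈ B, S z := by
    rintro y ⟨hy, c, hc, -, hyc⟩
    simp only [Set.mem_iUnion]
    exact ⟨y - c, (Set.Finite.mem_toFinset _).2 hyc, by simpa using hc, hy⟩
  have hsum : ((decodable C t N).ncard : ℝ) ≤ ∑ z ∈ B, ((S z).ncard : ℝ) := by
    exact_mod_cast (Set.ncard_le_ncard hsub (Set.toFinite _)).trans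
      (Finset.set_ncard_biUnion_le B S)
  have hSsub : ∀ z, S z ⊆ {y | y - z ∈ C ∧ LinearMap.ker y ⊓ T = N} := fun z y hy =>
    ⟨hy.1, by rw [hy.2, inf_eq_left.2 hNT]⟩
  have hS : ∀ z, ((S z).ncard : ℝ) ≤ A (Nat.card F) (finrank F K) (u - r) := fun z =>
    le_trans (by exact_mod_cast Set.ncard_le_ncard (hSsub z) (Set.toFinite _))
      (hC.ncard_translate_le hN hru hu hNT hT z)
  have hconst : ∑ _z ∈ B, A (Nat.card F) (finrank F K) (u - r) =
      A (Nat.card F) (finrank F K) (u - r) * (rankBall F V K t).ncard := by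
    rw [Finset.sum_const, hB, nsmul_eq_mul, mul_comm]
  rw [← hconst]
  refine ⟨hsum.trans (Finset.sum_le_sum fun z _ => hS z), ?_⟩
  rintro ⟨z, hz, y, hyz, hyT, hyN⟩
  refine hsum.trans_lt (Finset.sum_lt_sum (fun z _ => hS z)
    ⟨z, (Set.Finite.mem_toFinset _).2 hz, ?_⟩)
  refine lt_of_lt_of_le ?_ (hC.ncard_translate_le hN hru hu hNT hT z)
  exact_mod_cast Set.ncard_lt_ncard ((hSsub z).ssubset_of_not_subset
    fun h => hyN (h (⟨hyz, hyT⟩ : y ∈ {y | y - z ∈ C ∧ LinearMap.ker y ⊓ T = N})).2)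
    (Set.toFinite _)

theorem IsMRDMaps.exists_translate_inf_eq (hC : IsMRDMaps C k r) {N T : Submodule F V} {u t : ℕ}
    (hN : finrank F V = finrank F N + u) (hru : r < u) (hu : u ≤ finrank F K) (hNT : N ≤ T)
    (hT : finrank F T = k) (hr : 0 < r) (ht : t = r / 2) (h : ¬ (r = 1 ∧ u = 2)) :
    ∃ z ∈ rankBall F V K t, ∃ y, y - z ∈ C ∧ LinearMap.ker y ⊓ T = N ∧ LinearMap.ker y ≠ N := by
  have hkr := hC.add_eq
  rcases (Nat.succ_le_of_lt hru).lt_or_eq with hlt | heq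
  -- For u ≥ r + 2 take z = 0 and a codeword with kernel N + ⟨x⟩, x outside T; this has codimension
  -- u - 1 > r.
  · have hTt : T < ⊤ := Submodule.lt_top_of_finrank_lt_finrank (by omega)
    obtain ⟨x, -, hx⟩ := SetLike.exists_of_lt hTt
    have hxN : x ∉ N := fun h => hx (hNT h)
    have hx0 : x ≠ 0 := fun h => hx (h ▸ T.zero_mem)
    have hdim := finrank_sup_span_singleton_of_notMem hxN
    obtain ⟨y, hy, hker⟩ := hC.exists_ker_eq (N := N ⊔ F ∙ x) (v := u - 1) (by omega) (by omega)
      (by omega)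
    have h0 : (0 : V →ₗ[F] K) ∈ rankBall F V K t := by
      change finrank F (LinearMap.range (0 : V →ₗ[F] K)) ≤ t
      rw [LinearMap.range_zero, finrank_bot]
      exact Nat.zero_le t
    refine ⟨0, h0, y, by simpa using hy, ?_, ?_⟩
    · rw [hker, sup_inf_assoc_of_le _ hNT, inf_comm,
        ((Submodule.disjoint_span_singleton' hx0).2 hx).eq_bot, sup_bot_eq]
    · rw [hker]
      intro h
      rw [h] at hdim
      omega
  -- For u = r + 1, N is a hyperplane of T and r ≥ 2, so t ≥ 1: a rank-one map killing N but not w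
  -- lies in the ball, and y = z differs from it by the codeword 0.
  · obtain ⟨w, hwT, hwN⟩ := SetLike.exists_of_lt (hNT.lt_of_ne (by rintro rfl; omega))
    obtain ⟨φ, hφw, hφN⟩ := Submodule.exists_le_ker_of_notMem hwN
    have : Nontrivial K := nontrivial_of_finrank_pos (R := F) (by omega)
    obtain ⟨a, ha⟩ := exists_ne (0 : K)
    let z : V →ₗ[F] K := (LinearMap.toSpanSingleton F K a) ∘ₗ φ
    have hzker : LinearMap.ker z = LinearMap.ker φ := by
      ext x
      simp [z, ha]
    have hφ : finrank F (LinearMap.range φ) ≤ 1 := by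
      simpa using Submodule.finrank_le (LinearMap.range φ)
    have h1 := LinearMap.finrank_range_add_finrank_ker φ
    have h2 := LinearMap.finrank_range_add_finrank_ker z
    rw [hzker] at h2
    refine ⟨z, ?_, z, by simpa using hC.zero_mem, ?_, ?_⟩
    · change finrank F (LinearMap.range z) ≤ t
      omega
    · rw [hzker]
      refine (Submodule.eq_of_le_of_finrank_le (le_inf hφN hNT) ?_).symm
      have hlt : LinearMap.ker φ ⊓ T < T :=
        inf_le_right.lt_of_ne fun h => hφw (h.symm ▸ hwT : w ∈ LinearMap.ker φ ⊓ T).1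
      have := Submodule.finrank_lt_finrank_of_lt hlt
      omega
    · rw [hzker]
      intro h
      rw [h] at h1
      omega

/-- The number of decodable maps with a prescribed kernel of small codimension. -/
theorem IsMRDMaps.ncard_decodable_lt (hC : IsMRDMaps C k r) {N : Submodule F V} {u t : ℕ}
    (hN : finrank F V = finrank F N + u) (hur : u ≤ r) (htm : t + 2 ≤ finrank F K) :
    ((decodable C t N).ncard : ℝ) <
      (Nat.card F : ℝ) ^ 2 / ((Nat.card F : ℝ) ^ 2 - 1) *
        ((Nat.card F : ℝ) ^ finrank F K - 1) ^ ((u : ℤ) - (r : ℤ)) * (rankBall F V K t).ncard := by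
  classical
  have hkr := hC.add_eq
  have hfin := finite_linearMap (F := F) (V := V) (K := K)
  have := Fintype.ofFinite (Submodule F V)
  have hq : 1 < Nat.card F := Finite.one_lt_card
  have hq1 : (1 : ℝ) < Nat.card F := by exact_mod_cast hq
  have hq2 : (0 : ℝ) < (Nat.card F : ℝ) ^ 2 - 1 := sub_pos.2 (one_lt_pow₀ hq1 (by omega))
  have hQ : (0 : ℝ) < (Nat.card F : ℝ) ^ finrank F K - 1 :=
    sub_pos.2 (one_lt_pow₀ hq1 (by omega))
  let Z : Set (V →ₗ[F] K) := {z | z ∈ rankBall F V K t ∧ ∃ c ∈ C, c ≠ 0 ∧ ∀ x ∈ N, c x = -z x}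
  have hDZ : (decodable C t N).ncard ≤ Z.ncard := by
    have hex : ∀ y : decodable C t N, ∃ c ∈ C, c ≠ 0 ∧ finrank F (LinearMap.range (y.1 - c)) ≤ t :=
      fun y => y.2.2
    choose c hc hc0 hct using hex
    have hcN : ∀ y, ∀ x ∈ N, c y x = -(y.1 - c y) x := by
      intro y x hx
      have : x ∈ LinearMap.ker y.1 := y.2.1.symm ▸ hx
      simp [LinearMap.mem_ker.1 this]
    rw [← Nat.card_coe_set_eq, ← Nat.card_coe_set_eq]
    refine Nat.card_le_card_of_injective (fun y => (⟨y.1 - c y, hct y, c y, hc y, hc0 y, hcN y⟩ : Z))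
      fun y y' h => ?_
    have h1 : y.1 - c y = y'.1 - c y' := congrArg Subtype.val h
    -- dim N = n - u ≥ k, so the values on N determine the codeword.
    have h2 : c y = c y' := hC.eq_of_eqOn (T := N) (hc y) (hc y') (by omega)
      fun x hx => by rw [hcN y x hx, hcN y' x hx, h1]
    rw [h2] at h1
    exact Subtype.ext (sub_left_injective h1)
  set κ : ℝ := (Nat.card F : ℝ) ^ 2 / ((Nat.card F : ℝ) ^ 2 - 1) *
        ((Nat.card F : ℝ) ^ finrank F K - 1) ^ ((u : ℤ) - (r : ℤ)) with hκ
  have hκ0 : 0 < κ := by positivity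
  have hfiber : ∀ L : Submodule F V,
      {z | z ∈ Z ∧ LinearMap.ker z = L}.ncard ≤
        κ * {z | z ∈ rankBall F V K t ∧ LinearMap.ker z = L}.ncard ∧
      (L = ⊤ → {z | z ∈ Z ∧ LinearMap.ker z = L}.ncard <
        κ * {z | z ∈ rankBall F V K t ∧ LinearMap.ker z = L}.ncard) := by
    intro L
    obtain ⟨ρ, hρ⟩ := Nat.exists_eq_add_of_le (Submodule.finrank_le L)
    have hrank : ∀ z : V →ₗ[F] K, LinearMap.ker z = L → finrank F (LinearMap.range z) = ρ := by
      intro z hz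
      have := LinearMap.finrank_range_add_finrank_ker z
      rw [hz] at this
      omega
    by_cases hρt : ρ ≤ t
    · have hball : {z | z ∈ rankBall F V K t ∧ LinearMap.ker z = L} =
          {z : V →ₗ[F] K | LinearMap.ker z = L} := by
        ext z
        exact ⟨fun h => h.2, fun h => ⟨(hrank z h).le.trans hρt, h⟩⟩
      have hZ : {z | z ∈ Z ∧ LinearMap.ker z = L} =
          {z : V →ₗ[F] K | LinearMap.ker z = L ∧ ∃ c ∈ C, c ≠ 0 ∧ ∀ x ∈ N, c x = -z x} := by
        ext z
        exact ⟨fun h => ⟨h.2, h.1.2⟩, fun h => ⟨⟨(hrank z h.1).le.trans hρt, h.2⟩, h.1⟩⟩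
      have hApos := A_pos (a := ρ) hq (by omega : ρ ≤ finrank F K)
      have key : ({z | z ∈ Z ∧ LinearMap.ker z = L}.ncard : ℝ) <
          κ * {z | z ∈ rankBall F V K t ∧ LinearMap.ker z = L}.ncard := by
        rw [hball, hZ, ncard_ker_eq L hρ (by omega)]
        rcases Set.eq_empty_or_nonempty
          {z : V →ₗ[F] K | LinearMap.ker z = L ∧ ∃ c ∈ C, c ≠ 0 ∧ ∀ x ∈ N, c x = -z x} with h | h
        · rw [h, Set.ncard_empty, Nat.cast_zero]
          positivity
        · obtain ⟨hs, hle⟩ := hC.ncard_cancel_le hN hρ hur (by omega) h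
          refine hle.trans_lt ?_
          have hlt := A_sub_mul_lt hq hs (by omega : ρ + 2 ≤ finrank F K)
          have hexp : ((u : ℤ) - (r : ℤ)) = -((r - u : ℕ) : ℤ) := by
            push_cast [Nat.cast_sub hur]
            ring
          have hP : (0 : ℝ) < ((Nat.card F : ℝ) ^ finrank F K - 1) ^ (r - u) := pow_pos hQ _
          rw [hκ, hexp, zpow_neg, zpow_natCast, ← div_eq_mul_inv, div_div, div_mul_eq_mul_div,
            lt_div_iff₀ (mul_pos hq2 hP), ← mul_assoc]
          exact hlt
      exact ⟨key.le, fun _ => key⟩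
    · have hZ : {z | z ∈ Z ∧ LinearMap.ker z = L} = ∅ := by
        ext z
        simp only [Set.mem_ofPred_eq, Set.mem_empty_iff_false, iff_false]
        rintro ⟨hz, hzL⟩
        exact hρt ((hrank z hzL).symm.le.trans hz.1)
      rw [hZ, Set.ncard_empty, Nat.cast_zero]
      refine ⟨by positivity, ?_⟩
      rintro rfl
      rw [finrank_top] at hρ
      omega
  calc ((decodable C t N).ncard : ℝ) ≤ (Z.ncard : ℝ) := by exact_mod_cast hDZ
    _ = ∑ L : Submodule F V, ({z | z ∈ Z ∧ LinearMap.ker z = L}.ncard : ℝ) := by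
      rw [ncard_eq_sum_fiber LinearMap.ker Z, Nat.cast_sum]
    _ < ∑ L : Submodule F V, κ * {z | z ∈ rankBall F V K t ∧ LinearMap.ker z = L}.ncard :=
      -- L = V has codimension 0 ≤ t, so at least one term is strict.
      Finset.sum_lt_sum (fun L _ => (hfiber L).1) ⟨⊤, Finset.mem_univ _, (hfiber ⊤).2 rfl⟩
    _ = κ * (rankBall F V K t).ncard := by
      rw [← Finset.mul_sum, ncard_eq_sum_fiber LinearMap.ker (rankBall F V K t), Nat.cast_sum]

/-- Fibrewise bounds over the kernels of codimension `u` bound the proportion among the maps of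
rank `u`. -/
theorem div_le_of_fiber_le {u : ℕ} (hu : u ≤ finrank F V) (huK : u ≤ finrank F K)
    {E : Set (V →ₗ[F] K)} (hE : ∀ f ∈ E, finrank F (LinearMap.range f) = u) {b : ℝ} :
    ((∀ N : Submodule F V, finrank F V = finrank F N + u →
        ({f | f ∈ E ∧ LinearMap.ker f = N}.ncard : ℝ) ≤ b) →
      (E.ncard : ℝ) / ({f : V →ₗ[F] K | finrank F (LinearMap.range f) = u}.ncard : ℝ) ≤
        b / A (Nat.card F) (finrank F K) u) ∧
    ((∀ N : Submodule F V, finrank F V = finrank F N + u →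
        ({f | f ∈ E ∧ LinearMap.ker f = N}.ncard : ℝ) < b) →
      (E.ncard : ℝ) / ({f : V →ₗ[F] K | finrank F (LinearMap.range f) = u}.ncard : ℝ) <
        b / A (Nat.card F) (finrank F K) u) := by
  classical
  have hfin := finite_linearMap (F := F) (V := V) (K := K)
  have := Fintype.ofFinite (Submodule F V)
  have hA := A_pos (a := u) (m := finrank F K) (Finite.one_lt_card (α := F)) huK
  let J : Finset (Submodule F V) := Finset.univ.filter fun N => finrank F V = finrank F N + u
  have hJ : J.Nonempty := by
    obtain ⟨N, -, hN⟩ := exists_le_finrank_eq (⊥ : Submodule F V) (j := finrank F V - u)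
      (by simp) (by omega)
    exact ⟨N, Finset.mem_filter.2 ⟨Finset.mem_univ _, by omega⟩⟩
  have hsum : ∀ S : Set (V →ₗ[F] K), (∀ f ∈ S, finrank F (LinearMap.range f) = u) →
      (S.ncard : ℝ) = ∑ N ∈ J, ({f | f ∈ S ∧ LinearMap.ker f = N}.ncard : ℝ) := by
    intro S hS
    rw [ncard_eq_sum_fiber LinearMap.ker S, Nat.cast_sum]
    symm
    refine Finset.sum_subset (Finset.subset_univ _) fun N _ hN => ?_
    have : {f | f ∈ S ∧ LinearMap.ker f = N} = ∅ := by
      ext f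
      simp only [Set.mem_ofPred_eq, Set.mem_empty_iff_false, iff_false]
      rintro ⟨hf, rfl⟩
      refine hN (Finset.mem_filter.2 ⟨Finset.mem_univ _, ?_⟩)
      have := LinearMap.finrank_range_add_finrank_ker f
      have := hS f hf
      omega
    rw [this, Set.ncard_empty, Nat.cast_zero]
  have hall : ({f : V →ₗ[F] K | finrank F (LinearMap.range f) = u}.ncard : ℝ) =
      J.card * A (Nat.card F) (finrank F K) u := by
    rw [hsum {f : V →ₗ[F] K | finrank F (LinearMap.range f) = u} fun f hf => hf, ← nsmul_eq_mul, ← Finset.sum_const]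
    refine Finset.sum_congr rfl fun N hN => ?_
    have hN' := (Finset.mem_filter.1 hN).2
    rw [← ncard_ker_eq N hN' huK]
    congr 2
    ext f
    refine ⟨fun h => h.2, fun h => ⟨?_, h⟩⟩
    have h1 := LinearMap.finrank_range_add_finrank_ker f
    have h2 : LinearMap.ker f = N := h
    rw [h2] at h1
    change finrank F (LinearMap.range f) = u
    omega
  have hJ0 : (0 : ℝ) < J.card := by exact_mod_cast hJ.card_pos
  have hb : ∑ _N ∈ J, b = J.card * b := by rw [Finset.sum_const, nsmul_eq_mul]
  rw [hall, ← mul_div_mul_left b _ hJ0.ne', ← hb, hsum E hE]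
  refine ⟨fun h => ?_, fun h => ?_⟩
  · gcongr with N hN
    exact h N (Finset.mem_filter.1 hN).2
  · have := Finset.sum_lt_sum_of_nonempty hJ fun N hN => h N (Finset.mem_filter.1 hN).2
    gcongr

end Decoding

/-! ### From vectors and decoders to linear maps. -/

section Vectors

variable {F K : Type*} [Field F] [Field K] [Algebra F K] {n : ℕ}

/-- Vectors of length `n` over `K` as linear maps on `F ^ n`. -/
noncomputable def toMaps (F K : Type*) [Field F] [Field K] [Algebra F K] (n : ℕ) :
    (Fin n → K) ≃ₗ[F] ((Fin n → F) →ₗ[F] K) :=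
  (Pi.basisFun F (Fin n)).constr F

theorem finrank_range_toMaps (x : Fin n → K) :
    finrank F (LinearMap.range (toMaps F K n x)) = rankNorm F x := by
  rw [toMaps, Basis.constr_range, rankNorm]

theorem ncard_setOf_toMaps (p : ((Fin n → F) →ₗ[F] K) → Prop) :
    {x : Fin n → K | p (toMaps F K n x)}.ncard = {f | p f}.ncard :=
  Set.ncard_congr (fun x _ => toMaps F K n x) (fun _ h => h)
    (fun _ _ _ _ h => (toMaps F K n).injective h)
    fun f hf => ⟨(toMaps F K n).symm f,
      by simpa only [Set.mem_ofPred_eq, LinearEquiv.apply_symm_apply] using hf, by simp⟩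

theorem ballVolume_eq (t : ℕ) :
    ballVolume F K n t = (rankBall F (Fin n → F) K t).ncard := by
  rw [ballVolume, rankBall, ← ncard_setOf_toMaps]
  simp only [finrank_range_toMaps]

theorem IsMRD.parameters [Finite F] [Finite K] {C : Set (Fin n → K)} {k d : ℕ}
    (hC : IsMRD F C) (hk : C.ncard = Nat.card F ^ (finrank F K * k)) (hd : minRankDist F C = d) :
    0 < d ∧ 0 < k ∧ d + k = n + 1 ∧ ∀ x ∈ C, ∀ y ∈ C, x ≠ y → d ≤ rankNorm F (x - y) := by
  obtain ⟨hnt, hS⟩ := hC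
  have hk0 : 0 < k := by
    have h1 : 1 < C.ncard := (Set.one_lt_ncard (Set.toFinite C)).2 hnt
    rw [hk] at h1
    rcases Nat.eq_zero_or_pos k with rfl | h
    · simp at h1
    · exact h
  obtain ⟨x, hx, y, hy, hxy⟩ := hnt
  have hmem : d ∈ {d : ℕ | ∃ x ∈ C, ∃ y ∈ C, x ≠ y ∧ rankDist F x y = d} := by
    rw [← hd]
    exact Nat.sInf_mem ⟨_, x, hx, y, hy, hxy, rfl⟩
  refine ⟨?_, hk0, ?_, fun x hx y hy hxy => hd ▸ Nat.sInf_le ⟨x, hx, y, hy, hxy, rfl⟩⟩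
  · obtain ⟨x, -, y, -, hxy, rfl⟩ := hmem
    rw [rankDist, ← finrank_range_toMaps, Nat.pos_iff_ne_zero, Ne, Submodule.finrank_eq_zero,
      LinearMap.range_eq_bot, LinearEquiv.map_eq_zero_iff, sub_eq_zero]
    exact hxy
  · have hK : (1 : ℝ) < Nat.card K := by exact_mod_cast Finite.one_lt_card
    rw [hd, hk, pow_mul, ← Module.natCard_eq_pow_finrank (K := F), Nat.cast_pow, Real.logb_pow,
      Real.logb_self_eq_one hK, mul_one] at hS
    have : ((d + k : ℕ) : ℝ) = ((n + 1 : ℕ) : ℝ) := by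
      push_cast
      linarith
    exact_mod_cast this

/-- The code, translated to contain zero and regarded as a set of linear maps. -/
theorem IsMRD.isMRDMaps [Finite F] [Finite K] {C : Set (Fin n → K)} {k d : ℕ}
    (hC : IsMRD F C) (hk : C.ncard = Nat.card F ^ (finrank F K * k)) (hd : minRankDist F C = d)
    {c : Fin n → K} (hc : c ∈ C) :
    IsMRDMaps ((fun x => toMaps F K n (x - c)) '' C) k (d - 1) := by
  obtain ⟨hd0, -, hdk, hdist⟩ := hC.parameters hk hd
  refine ⟨?_, ?_, ?_, c, hc, by simp⟩
  · rw [← hk]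
    exact ((toMaps F K n).injective.comp (sub_left_injective (b := c))).injOn.ncard_image
  · rw [finrank_fin_fun]
    omega
  · rintro _ ⟨x, hx, rfl⟩ _ ⟨y, hy, rfl⟩ hxy
    rw [← map_sub, finrank_range_toMaps, sub_sub_sub_cancel_right]
    have := hdist x hx y hy (by rintro rfl; exact hxy rfl)
    omega

/-- The error probability is at most the proportion of the maps of rank `u` close to a nonzero
element of the translated code. -/
theorem decoderErrorProb_le [Finite K] {C : Set (Fin n → K)} {t : ℕ}
    {D : (Fin n → K) → Option (Fin n → K)} (hD : IsBoundedDistanceDecoder F C t D)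
    (c : Fin n → K) (u : ℕ) :
    decoderErrorProb F D c u ≤
      ({f : (Fin n → F) →ₗ[F] K | finrank F (LinearMap.range f) = u ∧
        ∃ g ∈ (fun x => toMaps F K n (x - c)) '' C, g ≠ 0 ∧
          finrank F (LinearMap.range (f - g)) ≤ t}.ncard : ℝ) /
      ({f : (Fin n → F) →ₗ[F] K | finrank F (LinearMap.range f) = u}.ncard : ℝ) := by
  rw [decoderErrorProb, ← ncard_setOf_toMaps,
    ← ncard_setOf_toMaps (fun f => finrank F (LinearMap.range f) = u)]
  simp only [finrank_range_toMaps]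
  refine div_le_div_of_nonneg_right (Nat.cast_le.2 (Set.ncard_le_ncard ?_ (Set.toFinite _)))
    (Nat.cast_nonneg _)
  rintro e ⟨he, c', hDc, hne⟩
  refine ⟨he, ?_⟩
  by_cases hex : ∃ x ∈ C, rankDist F (c + e) x ≤ t
  · obtain ⟨x, hx, hxt, hDx⟩ := (hD (c + e)).1 hex
    obtain rfl : x = c' := Option.some_injective _ (hDx.symm.trans hDc)
    refine ⟨_, ⟨x, hx, rfl⟩, ?_, ?_⟩
    · rw [Ne, LinearEquiv.map_eq_zero_iff, sub_eq_zero]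
      exact hne
    · rw [← map_sub, finrank_range_toMaps, show e - (x - c) = c + e - x by abel]
      exact hxt
  · rw [(hD (c + e)).2 hex] at hDc
    cases hDc

end Vectors

end RankMetric

theorem mainTheorem3 {F K : Type*} [Field F] [Finite F] [Field K] [Finite K] [Algebra F K]
    (q m n k r d t u : ℕ)
    (hq : Nat.card F = q) (hm : Module.finrank F K = m) (hnm : n ≤ m)
    (C : Set (Fin n → K)) (hC : RankMetric.IsMRD F C)
    (hk : C.ncard = q ^ (m * k)) (hr : r = n - k)
    (hd : RankMetric.minRankDist F C = d) (ht : t = (d - 1) / 2)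
    (D : (Fin n → K) → Option (Fin n → K))
    (hD : RankMetric.IsBoundedDistanceDecoder F C t D)
    (c : Fin n → K) (hc : c ∈ C) (hu : u ≤ n) :
    (d ≤ u + t → u < d →
      RankMetric.decoderErrorProb F D c u <
        (q : ℝ) ^ 2 / ((q : ℝ) ^ 2 - 1) *
          (((q : ℝ) ^ m - 1) ^ ((u : ℤ) - (r : ℤ)) / RankMetric.A q m u) *
          (RankMetric.ballVolume F K n t : ℝ)) ∧
    (d ≤ u →
      RankMetric.decoderErrorProb F D c u ≤
        RankMetric.A q m (u - r) / RankMetric.A q m u *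
          (RankMetric.ballVolume F K n t : ℝ)) ∧
    (d ≤ u → ¬ (d = 1 ∨ (d = 2 ∧ u = 2)) →
      RankMetric.decoderErrorProb F D c u <
        RankMetric.A q m (u - r) / RankMetric.A q m u *
          (RankMetric.ballVolume F K n t : ℝ)) := by
  subst hq hm
  obtain ⟨hd0, hk0, hdk, -⟩ := hC.parameters hk hd
  have hM := hC.isMRDMaps hk hd hc
  obtain rfl : d = r + 1 := by omega
  rw [Nat.add_sub_cancel] at hM ht
  have hn : Module.finrank F (Fin n → F) = n := Module.finrank_fin_fun F
  have hle := RankMetric.decoderErrorProb_le hD c u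
  set 𝒞 := (fun x => RankMetric.toMaps F K n (x - c)) '' C with h𝒞
  have hdiv := fun b => RankMetric.div_le_of_fiber_le (F := F) (V := Fin n → F) (K := K) (u := u)
    (hu.trans hn.ge) (hu.trans hnm)
    (E := {f | Module.finrank F (LinearMap.range f) = u ∧ ∃ g ∈ 𝒞, g ≠ 0 ∧
      Module.finrank F (LinearMap.range (f - g)) ≤ t}) (fun f hf => hf.1) (b := b)
  have hfin := RankMetric.finite_linearMap (F := F) (V := Fin n → F) (K := K)
  have hdec : ∀ N : Submodule F (Fin n → F),
      ({f | f ∈ {f | Module.finrank F (LinearMap.range f) = u ∧ ∃ g ∈ 𝒞, g ≠ 0 ∧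
        Module.finrank F (LinearMap.range (f - g)) ≤ t} ∧ LinearMap.ker f = N}.ncard : ℝ) ≤
      (RankMetric.decodable 𝒞 t N).ncard := by
    intro N
    exact Nat.cast_le.2 (Set.ncard_le_ncard (fun f hf => ⟨hf.2, hf.1.2⟩) (Set.toFinite _))
  have hT : r < u → ∀ N : Submodule F (Fin n → F),
      Module.finrank F (Fin n → F) = Module.finrank F N + u →
      ∃ T : Submodule F (Fin n → F), N ≤ T ∧ Module.finrank F T = k :=
    fun _ N hN => RankMetric.exists_le_finrank_eq N (by omega) (by omega)
  rw [RankMetric.ballVolume_eq]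
  refine ⟨fun h1 h2 => ?_, fun h1 => ?_, fun h1 h2 => ?_⟩
  · refine hle.trans_lt (((hdiv _).2 fun N hN => (hdec N).trans_lt
      -- d - t ≤ u < d forces t ≥ 1, so r ≥ 2; with m ≥ n ≥ r + 1 and t = ⌊r/2⌋ this gives t + 2 ≤
      -- m.
      (hM.ncard_decodable_lt hN (by omega) (by omega))).trans_eq (by ring))
  · refine hle.trans (((hdiv _).1 fun N hN => (hdec N).trans ?_).trans_eq (mul_div_right_comm _ _ _))
    obtain ⟨T, hNT, hTk⟩ := hT h1 N hN
    exact (hM.ncard_decodable_le hN (by omega) (hu.trans hnm) hNT hTk).1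
  · refine hle.trans_lt (((hdiv _).2 fun N hN => (hdec N).trans_lt ?_).trans_eq
      (mul_div_right_comm _ _ _))
    obtain ⟨T, hNT, hTk⟩ := hT h1 N hN
    exact (hM.ncard_decodable_le hN (by omega) (hu.trans hnm) hNT hTk).2
      (hM.exists_translate_inf_eq hN h1 (hu.trans hnm) hNT hTk (by omega) ht (by omega))
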